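/- Let $\mathbf{k}$ be an algebraically closed field of characteristic zero, let $n\ge 1$, write $n=2m+\epsilon$ with $m\ge 0$ an integer and $\epsilon\in\{0,1\}$, and let $R=\mathbf{k}[x_0,\dots,x_n]$. For a square-free homogeneous polynomial $f\in R$ of degree $d\geq 1$, let $\mathrm{Der}_0(f)$ be the graded $R$-module of all derivations $\delta=a_0\partial_{x_0}+\cdots+a_n\partial_{x_n}$ with $a_i\in R$ and $\delta(f)=0$, equivalently of all tuples $(a_0,\dots,a_n)\in R^{n+1}$ with $\sum_i a_i\,\partial f/\partial x_i=0$; its degree-$t$ part consists of those whose coefficients $a_i$ are all homogeneous of degree $t$. The reduced hypersurface $\{f=0\}\subset\mathbb{P}^n$ is called free with exponents $(d_1,\dots,d_n)$ if $\mathrm{Der}_0(f)\cong R(-d_1)\oplus\cdots\oplus R(-d_n)$ as graded $R$-modules and $d_1+\cdots+d_n=d-1$. For $0\le i\le n$ put $h_i=\prod_{j\ne i}x_j$, and let $$f_1=\sum_{i=m+1}^{n}h_i,\qquad f_2=\sum_{i=0}^{m}h_i .$$ Then: (i) The hypersurface $\{f_1f_2=0\}$ is reduced and free with exponents $(1,2,\dots,2)$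 (one $1$ and $n-1$ entries $2$). (ii) For every integer $k\ge 3$ there is a nonempty Zariski open set $U\subset(\mathbf{k}^2)^{k-2}$ such that for all $\big((a_3,b_3),\dots,(a_k,b_k)\big)\in U$ the hypersurface $$\Big\{f_1f_2\prod_{i=3}^{k}(a_if_1+b_if_2)=0\Big\}$$ is reduced and free with exponents $(2,\dots,2,\,n(k-2)+1)$ (with $n-1$ entries $2$). -/

import Mathlib

open MvPolynomial

noncomputable section

/-- The `R`-module `Der₀(f)` of all Jacobian relations of `f`, `R = K[x₀, …, xₙ]`: the tuples
`(a₀, …, aₙ) ∈ Rⁿ⁺¹` with `a₀ ∂f/∂x₀ + ⋯ + aₙ ∂f/∂xₙ = 0`, i.e. the derivations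
`δ = a₀∂₀ + ⋯ + aₙ∂ₙ` of `R` with `δ(f) = 0`, written in the basis `∂₀, …, ∂ₙ` of `Der(R)`. -/
def derZero {K : Type*} [Field K] {n : ℕ} (f : MvPolynomial (Fin (n + 1)) K) :
    Submodule (MvPolynomial (Fin (n + 1)) K) (Fin (n + 1) → MvPolynomial (Fin (n + 1)) K) where
  carrier := {a | ∑ i, a i * pderiv i f = 0}
  add_mem' := by
    intro a b ha hb
    change ∑ i, _ = 0 at ha hb
    change ∑ i, _ = 0
    simp [add_mul, Finset.sum_add_distrib, ha, hb]
  zero_mem' := by simp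
  smul_mem' := by
    intro c a ha
    change ∑ i, _ = 0 at ha
    change ∑ i, _ = 0
    simp [mul_assoc, ← Finset.mul_sum, ha]

/-- The hypersurface `f = 0` in `ℙⁿ` is reduced and free with exponents `(d₁, …, dₙ)`:
`f` is a square-free form, `Der₀(f) ≅ R(-d₁) ⊕ ⋯ ⊕ R(-dₙ)` as graded `R`-modules, i.e. `Der₀(f)`
has an `R`-basis whose `i`-th element is homogeneous of degree `dᵢ` (all its coefficients
`aⱼ` are forms of degree `dᵢ` or zero), and `d₁ + ⋯ + dₙ = deg f - 1`. -/
structure IsFreeWithExponents {K : Type*} [Field K] {n : ℕ}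
    (f : MvPolynomial (Fin (n + 1)) K) (d : Fin n → ℕ) : Prop where
  homogeneous : f.IsHomogeneous f.totalDegree
  reduced : Squarefree f
  graded_free : ∃ b : Module.Basis (Fin n) (MvPolynomial (Fin (n + 1)) K) (derZero f),
    ∀ i j, ((b i : Fin (n + 1) → MvPolynomial (Fin (n + 1)) K) j).IsHomogeneous (d i)
  sum_exponents : (∑ i, d i) + 1 = f.totalDegree

/-- `hᵢ = x₀ ⋯ x̂ᵢ ⋯ xₙ`. -/
def hForm (K : Type*) [Field K] {n : ℕ} (i : Fin (n + 1)) : MvPolynomial (Fin (n + 1)) K :=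
  ∏ j ∈ Finset.univ.erase i, X j

/-- `f₁ = h_{m+1} + ⋯ + hₙ`. -/
def fOne (K : Type*) [Field K] (n m : ℕ) : MvPolynomial (Fin (n + 1)) K :=
  ∑ i ∈ Finset.univ.filter (fun i : Fin (n + 1) => m < (i : ℕ)), hForm K i

/-- `f₂ = h₀ + ⋯ + hₘ`. -/
def fTwo (K : Type*) [Field K] (n m : ℕ) : MvPolynomial (Fin (n + 1)) K :=
  ∑ i ∈ Finset.univ.filter (fun i : Fin (n + 1) => (i : ℕ) ≤ m), hForm K i

/-- The form `a f₁ + b f₂` defining the member `S_{a,b}` of the pencil. -/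
def pencilMember {K : Type*} [Field K] (n m : ℕ) (a b : K) : MvPolynomial (Fin (n + 1)) K :=
  C a * fOne K n m + C b * fTwo K n m

/-- `p` holds for the generic point of the affine space `K^σ` (`K` infinite): it holds on a
nonempty Zariski open subset, equivalently on the complement of the zero set of some nonzero
polynomial. -/
def HoldsGenerically {K : Type*} [Field K] {σ : Type*} (p : (σ → K) → Prop) : Prop :=
  ∃ P : MvPolynomial σ K, P ≠ 0 ∧ ∀ c : σ → K, eval c P ≠ 0 → p c

end

/-!
Put `f₁ = ∑_{i ∈ A} hᵢ` and `f₂ = ∑_{i ∉ A} hᵢ`. The argument works for every nonempty proper set `A`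
of indices and for every product `F = f₁ f₂ H`, `H = ∏ⱼ (αⱼ f₁ + βⱼ f₂)`, of `r + 2` pairwise
distinct members of the pencil; part (i) is the case `r = 0`.

*Reducedness.* Every member of the pencil has degree at most one in each variable, hence is
square-free. Two distinct members are coprime because `f₁` and `f₂` are: a common prime factor is not
a variable, so it divides `f₁ / xᵢ` (for `i ∉ A`) and `f₂ / xᵢ` (for `i ∈ A`), which are free of `xᵢ`,
and therefore it is constant (`isRelPrime_hSum_compl`, `squarefree_pencilProd`).

*Freeness.* The relations are parametrized explicitly. Since `F` is square-free, a derivation `a` with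
`a(F) = 0` is logarithmic along each of its factors. Along `xᵢ`, which divides `f₁ f₂`, this gives
`aᵢ = xᵢ bᵢ`. Along `f₁` it gives a `c₁` with `∑_{i ∈ A} (bᵢ - c₁) hᵢ = 0`, so that `bᵢ = c₁ + xᵢ eᵢ`
on `A` with `∑_A eᵢ = 0`. Likewise `bᵢ = c₂ + xᵢ eᵢ` off `A`, with vanishing sum of the `eᵢ`.
Along the remaining factors it gives `c₁ - c₂ = H w`. Conversely such an `a` multiplies `f₁` by
`T - H w` and `f₂` by `T`, where `T = n c₂ + |A| H w + ∑ xᵢ eᵢ`, so that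
`a(F) = f₁ f₂ H ((r + 2) T - w (H + f₁ ∂H/∂f₁))`; in characteristic zero its vanishing determines `c₂`
from `w` and `e` (`eq_eulerCoeff_iff`). Hence `(w, e) ↦ logField A α β (w, e)` is an isomorphism from
the free module of rank `1 + (n - 1)` of all `(w, e)` with `∑_A eᵢ = ∑_{Aᶜ} eᵢ = 0` onto `Der₀(F)`
(`logField_mem_derZero`, `exists_eq_logField`, `eq_zero_of_logField_eq_zero`). The basis element of `w` has degree `nr + 1`; those of the free
entries of `e` have degree `2`.
-/

noncomputable section

/-! ### Polynomials of degree at most one in each variable -/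

theorem isUnit_of_forall_degreeOf_eq_zero {σ K : Type*} [Field K] {g : MvPolynomial σ K}
    (hg : g ≠ 0) (h : ∀ i, g.degreeOf i = 0) : IsUnit g := by
  have h0 : g.totalDegree = 0 := by
    rw [totalDegree_eq_zero_iff]
    intro s hs i
    have := monomial_le_degreeOf i hs
    rw [h i] at this
    omega
  rw [totalDegree_eq_zero_iff_eq_C] at h0
  rw [h0] at hg ⊢
  refine IsUnit.map C (isUnit_iff_ne_zero.2 fun hc => hg ?_)
  rw [hc, C_0]

/-- A square factor `g²` would have degree at most `1`, hence degree `0`, in each variable. -/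
theorem squarefree_of_forall_degreeOf_le_one {σ K : Type*} [Field K] {f : MvPolynomial σ K}
    (hf : f ≠ 0) (h : ∀ i, f.degreeOf i ≤ 1) : Squarefree f := by
  rintro g ⟨q, rfl⟩
  have hq : q ≠ 0 := right_ne_zero_of_mul hf
  have hg : g ≠ 0 := left_ne_zero_of_mul (left_ne_zero_of_mul hf)
  refine isUnit_of_forall_degreeOf_eq_zero hg fun i => ?_
  have := h i
  rw [degreeOf_mul_eq (mul_ne_zero hg hg) hq, degreeOf_mul_eq hg hg] at this
  omega

/-! ### The forms `hᵢ` and their partial sums -/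

section PartialSums

variable {K : Type*} [Field K] {n : ℕ}

theorem X_mul_hForm (i : Fin (n + 1)) :
    X i * hForm K i = ∏ j, (X j : MvPolynomial (Fin (n + 1)) K) :=
  Finset.mul_prod_erase _ _ (Finset.mem_univ i)

theorem X_dvd_hForm {i j : Fin (n + 1)} (h : j ≠ i) :
    (X j : MvPolynomial (Fin (n + 1)) K) ∣ hForm K i :=
  Finset.dvd_prod_of_mem _ (Finset.mem_erase.2 ⟨h, Finset.mem_univ j⟩)

theorem not_X_dvd_hForm (i : Fin (n + 1)) :
    ¬ (X i : MvPolynomial (Fin (n + 1)) K) ∣ hForm K i := by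
  intro h
  obtain ⟨j, hj, hij⟩ := (Prime.dvd_finsetProd_iff X_prime _).1 h
  rw [X_dvd_X] at hij
  exact (Finset.mem_erase.1 hj).1 hij.symm

theorem degreeOf_hForm_le_one (i j : Fin (n + 1)) : (hForm K i).degreeOf j ≤ 1 := by
  classical
  refine (degreeOf_prod_le _ _ _).trans ?_
  simp only [degreeOf_X]
  rw [Finset.sum_ite_eq]
  split_ifs <;> simp

theorem isHomogeneous_hForm (i : Fin (n + 1)) : (hForm K i).IsHomogeneous n := by
  have := IsHomogeneous.prod (Finset.univ.erase i)
    (fun j => (X j : MvPolynomial (Fin (n + 1)) K)) (fun _ => 1) fun j _ => isHomogeneous_X K j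
  simpa [hForm] using this

/-- The sum of the `hᵢ` with `i ∈ A`; thus `f₁` and `f₂` are the sums for two complementary
sets of indices. -/
def hSum (K : Type*) [Field K] {n : ℕ} (A : Finset (Fin (n + 1))) :
    MvPolynomial (Fin (n + 1)) K :=
  ∑ i ∈ A, hForm K i

theorem isHomogeneous_hSum (A : Finset (Fin (n + 1))) : (hSum K A).IsHomogeneous n :=
  IsHomogeneous.sum _ _ _ fun i _ => isHomogeneous_hForm i

theorem degreeOf_hSum_le_one (A : Finset (Fin (n + 1))) (j : Fin (n + 1)) :
    (hSum K A).degreeOf j ≤ 1 :=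
  (degreeOf_sum_le _ _ _).trans (Finset.sup_le fun i _ => degreeOf_hForm_le_one i j)

theorem X_dvd_hSum {A : Finset (Fin (n + 1))} {i : Fin (n + 1)} (h : i ∉ A) :
    (X i : MvPolynomial (Fin (n + 1)) K) ∣ hSum K A :=
  Finset.dvd_sum fun _ hj => X_dvd_hForm fun hij => h (hij ▸ hj)

theorem not_X_dvd_hSum {A : Finset (Fin (n + 1))} {i : Fin (n + 1)} (h : i ∈ A) :
    ¬ (X i : MvPolynomial (Fin (n + 1)) K) ∣ hSum K A := by
  classical
  intro hd
  rw [hSum, ← Finset.add_sum_erase _ _ h] at hd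
  refine not_X_dvd_hForm (K := K) i ((dvd_add_left ?_).1 hd)
  exact X_dvd_hSum (Finset.notMem_erase i A)

theorem hSum_ne_zero {A : Finset (Fin (n + 1))} (hA : A.Nonempty) : hSum K A ≠ 0 := by
  obtain ⟨i, hi⟩ := hA
  intro h
  exact not_X_dvd_hSum (K := K) hi (h ▸ dvd_zero _)

/-- If `i ∉ A`, then `hSum K A = xᵢ q` with `q` free of `xᵢ`, and `p` divides `q`. -/
theorem degreeOf_eq_zero_of_dvd_hSum {A : Finset (Fin (n + 1))} (hA : A.Nonempty)
    {p : MvPolynomial (Fin (n + 1)) K} (hp : Prime p) (hpA : p ∣ hSum K A) {i : Fin (n + 1)}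
    (hi : i ∉ A) (hpi : ¬ p ∣ X i) : p.degreeOf i = 0 := by
  obtain ⟨q, hq⟩ := X_dvd_hSum (K := K) hi
  have hne := hSum_ne_zero (K := K) hA
  have hdeg := degreeOf_hSum_le_one (K := K) A i
  rw [hq] at hpA hne hdeg
  have hq0 := right_ne_zero_of_mul hne
  rw [degreeOf_mul_eq (X_ne_zero i) hq0, degreeOf_X_self] at hdeg
  obtain ⟨r, rfl⟩ := (hp.dvd_or_dvd hpA).resolve_left hpi
  rw [degreeOf_mul_eq (left_ne_zero_of_mul hq0) (right_ne_zero_of_mul hq0)] at hdeg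
  omega

theorem not_dvd_X_of_dvd_hSum {A : Finset (Fin (n + 1))} {p : MvPolynomial (Fin (n + 1)) K}
    (hp : Prime p) (hpA : p ∣ hSum K A) {i : Fin (n + 1)} (hi : i ∈ A) : ¬ p ∣ X i := fun h =>
  not_X_dvd_hSum hi (((hp.associated_of_dvd X_prime h).dvd_iff_dvd_left).1 hpA)

theorem isRelPrime_hSum_compl {A : Finset (Fin (n + 1))} (hA : A.Nonempty) (hA' : Aᶜ.Nonempty) :
    IsRelPrime (hSum K A) (hSum K Aᶜ) := by
  refine WfDvdMonoid.isRelPrime_of_no_irreducible_factors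
    (fun h => hSum_ne_zero hA h.1) fun p hirr h₁ h₂ => ?_
  have hp := hirr.prime
  have hX : ∀ i, ¬ p ∣ X i := fun i => by
    by_cases hi : i ∈ A
    · exact not_dvd_X_of_dvd_hSum hp h₁ hi
    · exact not_dvd_X_of_dvd_hSum hp h₂ (Finset.mem_compl.2 hi)
  refine hirr.not_isUnit (isUnit_of_forall_degreeOf_eq_zero hp.ne_zero fun i => ?_)
  by_cases hi : i ∈ A
  · exact degreeOf_eq_zero_of_dvd_hSum hA' hp h₂ (fun h => Finset.mem_compl.1 h hi) (hX i)
  · exact degreeOf_eq_zero_of_dvd_hSum hA hp h₁ hi (hX i)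

end PartialSums

/-! ### Members of the pencil -/

section Pencil

variable {K : Type*} [Field K] {n : ℕ}

/-- The member `a f₁ + b f₂` of the pencil spanned by `hSum K A` and `hSum K Aᶜ`. -/
def pencilForm (A : Finset (Fin (n + 1))) (a b : K) : MvPolynomial (Fin (n + 1)) K :=
  C a * hSum K A + C b * hSum K Aᶜ

theorem isHomogeneous_pencilForm (A : Finset (Fin (n + 1))) (a b : K) :
    (pencilForm A a b).IsHomogeneous n :=
  ((isHomogeneous_hSum A).C_mul a).add ((isHomogeneous_hSum Aᶜ).C_mul b)

theorem isRelPrime_pencilForm {A : Finset (Fin (n + 1))} (hA : A.Nonempty) (hA' : Aᶜ.Nonempty)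
    {a b a' b' : K} (h : a * b' - a' * b ≠ 0) :
    IsRelPrime (pencilForm A a b) (pencilForm A a' b') := by
  intro g h₁ h₂
  have hu : IsUnit (C (a * b' - a' * b) : MvPolynomial (Fin (n + 1)) K) :=
    IsUnit.map C (isUnit_iff_ne_zero.2 h)
  refine isRelPrime_hSum_compl hA hA' ?_ ?_
  · rw [← hu.dvd_mul_left]
    have e : C (a * b' - a' * b) * hSum K A
        = C b' * pencilForm A a b - C b * pencilForm A a' b' := by
      simp only [pencilForm, C_sub, C_mul]; ring
    rw [e]
    exact dvd_sub (h₁.mul_left _) (h₂.mul_left _)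
  · rw [← hu.dvd_mul_left]
    have e : C (a * b' - a' * b) * hSum K Aᶜ
        = C a * pencilForm A a' b' - C a' * pencilForm A a b := by
      simp only [pencilForm, C_sub, C_mul]; ring
    rw [e]
    exact dvd_sub (h₂.mul_left _) (h₁.mul_left _)

theorem pencilForm_one_zero (A : Finset (Fin (n + 1))) :
    pencilForm A (1 : K) 0 = hSum K A := by simp [pencilForm]

theorem pencilForm_zero_one (A : Finset (Fin (n + 1))) :
    pencilForm A (0 : K) 1 = hSum K Aᶜ := by simp [pencilForm]

theorem pencilForm_ne_zero {A : Finset (Fin (n + 1))} (hA : A.Nonempty) (hA' : Aᶜ.Nonempty)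
    {a b : K} (h : a ≠ 0 ∨ b ≠ 0) : pencilForm A a b ≠ 0 := by
  intro h0
  -- the zero form is not coprime to `f₁` or `f₂`, which are divisible by variables
  have hX : ∀ i, ∀ f : MvPolynomial (Fin (n + 1)) K, IsRelPrime (pencilForm A a b) f →
      ¬ X i ∣ f := fun i f hf hd =>
    (X_prime (R := K) (i := i)).not_isUnit (hf (h0 ▸ dvd_zero _) hd)
  obtain ⟨i, hi⟩ := hA
  obtain ⟨j, hj⟩ := hA'
  rcases h with h | h
  · refine hX i (hSum K Aᶜ) ?_ (X_dvd_hSum fun h => Finset.mem_compl.1 h hi)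
    rw [← pencilForm_zero_one]
    exact isRelPrime_pencilForm ⟨i, hi⟩ ⟨j, hj⟩ (by simpa using h)
  · refine hX j (hSum K A) ?_ (X_dvd_hSum (Finset.mem_compl.1 hj))
    rw [← pencilForm_one_zero]
    exact isRelPrime_pencilForm ⟨i, hi⟩ ⟨j, hj⟩ (by simpa using h)

theorem squarefree_pencilForm {A : Finset (Fin (n + 1))} (hA : A.Nonempty) (hA' : Aᶜ.Nonempty)
    {a b : K} (h : a ≠ 0 ∨ b ≠ 0) : Squarefree (pencilForm A a b) :=
  squarefree_of_forall_degreeOf_le_one (pencilForm_ne_zero hA hA' h) fun i =>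
    (degreeOf_add_le _ _ _).trans (max_le
      ((degreeOf_C_mul_le _ _ _).trans (degreeOf_hSum_le_one A i))
      ((degreeOf_C_mul_le _ _ _).trans (degreeOf_hSum_le_one Aᶜ i)))

/-- The product `f₁ f₂ ∏ⱼ (αⱼ f₁ + βⱼ f₂)` of members of the pencil. -/
def pencilProd (A : Finset (Fin (n + 1))) {r : ℕ} (α β : Fin r → K) :
    MvPolynomial (Fin (n + 1)) K :=
  hSum K A * hSum K Aᶜ * ∏ j, pencilForm A (α j) (β j)

/-- The points `(αⱼ : βⱼ)` of `ℙ¹` are pairwise distinct and different from `(1 : 0)`, `(0 : 1)`. -/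
structure IsGeneralPosition {r : ℕ} (α β : Fin r → K) : Prop where
  left_ne_zero : ∀ j, α j ≠ 0
  right_ne_zero : ∀ j, β j ≠ 0
  det_ne_zero : ∀ i j, i ≠ j → α i * β j - α j * β i ≠ 0

variable {A : Finset (Fin (n + 1))} {r : ℕ} {α β : Fin r → K}

theorem isHomogeneous_prod_pencilForm (A : Finset (Fin (n + 1))) (α β : Fin r → K)
    (s : Finset (Fin r)) :
    (∏ j ∈ s, pencilForm A (α j) (β j)).IsHomogeneous (n * s.card) := by
  have := IsHomogeneous.prod s (fun j => pencilForm A (α j) (β j)) (fun _ => n)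
    fun j _ => isHomogeneous_pencilForm A (α j) (β j)
  simpa [mul_comm] using this

theorem isHomogeneous_pencilProd (A : Finset (Fin (n + 1))) (α β : Fin r → K) :
    (pencilProd A α β).IsHomogeneous (n * (r + 2)) := by
  have := ((isHomogeneous_hSum (K := K) A).mul (isHomogeneous_hSum Aᶜ)).mul
    (isHomogeneous_prod_pencilForm A α β Finset.univ)
  rw [Finset.card_univ, Fintype.card_fin] at this
  rwa [show n + n + n * r = n * (r + 2) by ring] at this

theorem isRelPrime_hSum_pencilForm (hA : A.Nonempty) (hA' : Aᶜ.Nonempty)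
    (h : IsGeneralPosition α β) (j : Fin r) :
    IsRelPrime (hSum K A) (pencilForm A (α j) (β j)) := by
  rw [← pencilForm_one_zero]
  exact isRelPrime_pencilForm hA hA' (by simpa using h.right_ne_zero j)

theorem isRelPrime_hSum_compl_pencilForm (hA : A.Nonempty) (hA' : Aᶜ.Nonempty)
    (h : IsGeneralPosition α β) (j : Fin r) :
    IsRelPrime (hSum K Aᶜ) (pencilForm A (α j) (β j)) := by
  rw [← pencilForm_zero_one]
  exact isRelPrime_pencilForm hA hA' (by simpa using h.left_ne_zero j)

theorem squarefree_pencilProd (hA : A.Nonempty) (hA' : Aᶜ.Nonempty)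
    (h : IsGeneralPosition α β) : Squarefree (pencilProd A α β) := by
  rw [pencilProd, squarefree_mul_iff, squarefree_mul_iff]
  refine ⟨IsRelPrime.prod_right fun j _ => IsRelPrime.mul_left
    (isRelPrime_hSum_pencilForm hA hA' h j) (isRelPrime_hSum_compl_pencilForm hA hA' h j),
    ⟨isRelPrime_hSum_compl hA hA', ?_, ?_⟩, ?_⟩
  · rw [← pencilForm_one_zero]
    exact squarefree_pencilForm hA hA' (Or.inl one_ne_zero)
  · rw [← pencilForm_zero_one]
    exact squarefree_pencilForm hA hA' (Or.inr one_ne_zero)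
  · refine Finset.squarefree_prod_of_pairwise_isCoprime (fun i _ j _ hij => ?_) fun j _ =>
      squarefree_pencilForm hA hA' (Or.inl (h.left_ne_zero j))
    exact isRelPrime_pencilForm hA hA' (h.det_ne_zero i j hij)

end Pencil

/-! ### Derivations acting on the pencil -/

section Derivations

variable {K : Type*} [Field K] {n : ℕ}

theorem mem_derZero_iff {f : MvPolynomial (Fin (n + 1)) K}
    {a : Fin (n + 1) → MvPolynomial (Fin (n + 1)) K} :
    a ∈ derZero f ↔ mkDerivation K a f = 0 := by
  have hs : ∀ g, (∑ i, a i • pderiv i : Derivation K _ _) g = ∑ i, a i * pderiv i g := fun g =>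
    (congrFun (map_sum Derivation.coeFnAddMonoidHom (fun i => a i • pderiv i)
      Finset.univ) g).trans (Finset.sum_apply g _ _)
  have h : mkDerivation K a = ∑ i, a i • pderiv i := by
    refine derivation_ext fun j => ?_
    rw [mkDerivation_X, hs, Finset.sum_eq_single j]
    · simp
    · intro i _ hij
      simp [pderiv_X_of_ne hij.symm]
    · simp
  change ∑ i, a i * pderiv i f = 0 ↔ _
  rw [h, hs]

theorem derivation_finset_prod {R S ι : Type*} [CommRing R] [CommRing S] [Algebra R S]
    [DecidableEq ι] (D : Derivation R S S) (s : Finset ι) (f : ι → S) :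
    D (∏ i ∈ s, f i) = ∑ i ∈ s, (∏ j ∈ s.erase i, f j) * D (f i) := by
  induction s using Finset.induction_on with
  | empty => simp
  | insert a s ha ih =>
    rw [Finset.prod_insert ha, D.leibniz, ih, Finset.sum_insert ha, Finset.erase_insert ha,
      smul_eq_mul, smul_eq_mul, Finset.mul_sum, add_comm]
    congr 1
    refine Finset.sum_congr rfl fun i hi => ?_
    have hia : a ≠ i := fun h => ha (h ▸ hi)
    rw [Finset.erase_insert_of_ne hia,
      Finset.prod_insert fun h => ha (Finset.mem_of_mem_erase h), mul_assoc]

/-- A derivation killing a square-free product is logarithmic along each factor. -/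
theorem dvd_derivation_of_squarefree_mul {S R : Type*} [CommRing R] [CommRing S] [Algebra R S]
    (D : Derivation R S S) {g q : S} (h : IsRelPrime g q) [DecompositionMonoid S]
    (h0 : D (g * q) = 0) : g ∣ D g := by
  rw [D.leibniz, smul_eq_mul, smul_eq_mul] at h0
  exact h.dvd_of_dvd_mul_left ⟨-D q, by linear_combination h0⟩

variable {D : Derivation K (MvPolynomial (Fin (n + 1)) K) (MvPolynomial (Fin (n + 1)) K)}
  {b : Fin (n + 1) → MvPolynomial (Fin (n + 1)) K} {A : Finset (Fin (n + 1))}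

theorem derivation_hForm (hb : ∀ i, D (X i) = X i * b i) (i : Fin (n + 1)) :
    D (hForm K i) = (∑ j, b j - b i) * hForm K i := by
  rw [hForm, derivation_finset_prod, ← Finset.add_sum_erase _ _ (Finset.mem_univ i),
    add_sub_cancel_left, Finset.sum_mul]
  refine Finset.sum_congr rfl fun j hj => ?_
  rw [hb, ← Finset.mul_prod_erase _ _ hj]
  ring

theorem derivation_hSum (hb : ∀ i, D (X i) = X i * b i) (A : Finset (Fin (n + 1))) :
    D (hSum K A) = (∑ j, b j) * hSum K A - ∑ i ∈ A, b i * hForm K i := by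
  rw [hSum, map_sum, Finset.mul_sum, ← Finset.sum_sub_distrib]
  refine Finset.sum_congr rfl fun i _ => ?_
  rw [derivation_hForm hb]
  ring

theorem sum_add_X_mul_mul_hForm (c : MvPolynomial (Fin (n + 1)) K)
    (e : Fin (n + 1) → MvPolynomial (Fin (n + 1)) K) :
    ∑ i ∈ A, (c + X i * e i) * hForm K i = c * hSum K A + (∏ j, X j) * ∑ i ∈ A, e i := by
  rw [hSum, Finset.mul_sum, Finset.mul_sum, ← Finset.sum_add_distrib]
  refine Finset.sum_congr rfl fun i _ => ?_
  rw [← X_mul_hForm i]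
  ring

theorem derivation_hSum_of_eq_add (hb : ∀ i, D (X i) = X i * b i)
    {c : MvPolynomial (Fin (n + 1)) K} {e : Fin (n + 1) → MvPolynomial (Fin (n + 1)) K}
    (hc : ∀ i ∈ A, b i = c + X i * e i) (he : ∑ i ∈ A, e i = 0) :
    D (hSum K A) = (∑ j, b j - c) * hSum K A := by
  have hs : ∑ i ∈ A, b i * hForm K i = ∑ i ∈ A, (c + X i * e i) * hForm K i :=
    Finset.sum_congr rfl fun i hi => by rw [hc i hi]
  rw [derivation_hSum hb, hs, sum_add_X_mul_mul_hForm, he]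
  ring

theorem prod_X_ne_zero : (∏ j, X j : MvPolynomial (Fin (n + 1)) K) ≠ 0 :=
  Finset.prod_ne_zero_iff.2 fun j _ => X_ne_zero j

/-- The relations `∑ tᵢ hᵢ = 0` force `xᵢ ∣ tᵢ`, as `xᵢ` divides `hⱼ` for all `j ≠ i`. -/
theorem X_dvd_of_sum_mul_hForm_eq_zero {t : Fin (n + 1) → MvPolynomial (Fin (n + 1)) K}
    (h : ∑ i ∈ A, t i * hForm K i = 0) {i : Fin (n + 1)} (hi : i ∈ A) : X i ∣ t i := by
  classical
  rw [← Finset.add_sum_erase _ _ hi] at h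
  have hd : X i ∣ ∑ j ∈ A.erase i, t j * hForm K j := Finset.dvd_sum fun j hj =>
    (X_dvd_hForm (Finset.ne_of_mem_erase hj).symm).mul_left _
  have : X i ∣ t i * hForm K i := by
    rw [eq_neg_of_add_eq_zero_left h]
    exact hd.neg_right
  exact (X_prime.dvd_or_dvd this).resolve_right (not_X_dvd_hForm i)

theorem exists_eq_add_of_hSum_dvd (hb : ∀ i, D (X i) = X i * b i)
    (h : hSum K A ∣ D (hSum K A)) :
    ∃ (c : MvPolynomial (Fin (n + 1)) K) (e : Fin (n + 1) → MvPolynomial (Fin (n + 1)) K),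
      (∀ i ∈ A, b i = c + X i * e i) ∧ ∑ i ∈ A, e i = 0 := by
  rw [derivation_hSum hb] at h
  obtain ⟨c, hc⟩ := (dvd_sub_right (dvd_mul_left _ _)).1 h
  have h0 : ∑ i ∈ A, (b i - c) * hForm K i = 0 := by
    simp only [sub_mul, Finset.sum_sub_distrib, ← Finset.mul_sum]
    rw [hc, hSum]
    ring
  have he : ∀ i, ∃ e, i ∈ A → b i - c = X i * e := fun i => by
    by_cases hi : i ∈ A
    · obtain ⟨e, he⟩ := X_dvd_of_sum_mul_hForm_eq_zero h0 hi
      exact ⟨e, fun _ => he⟩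
    · exact ⟨0, fun h => absurd h hi⟩
  choose e he using he
  refine ⟨c, e, fun i hi => by linear_combination he i hi, ?_⟩
  rw [Finset.sum_congr rfl fun i hi => by rw [he i hi, ← zero_add (X i * e i)],
    sum_add_X_mul_mul_hForm, zero_mul, zero_add] at h0
  exact (mul_eq_zero.1 h0).resolve_left prod_X_ne_zero

/-- With `H = ∏ⱼ (αⱼ f₁ + βⱼ f₂)` regarded as a form in `f₁` and `f₂`, this is
`H + f₁ ∂H/∂f₁`. -/
def pencilPolar (A : Finset (Fin (n + 1))) {r : ℕ} (α β : Fin r → K) :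
    MvPolynomial (Fin (n + 1)) K :=
  ∏ j, pencilForm A (α j) (β j) +
    hSum K A * ∑ j, C (α j) * ∏ i ∈ Finset.univ.erase j, pencilForm A (α i) (β i)

theorem isHomogeneous_pencilPolar (A : Finset (Fin (n + 1))) {r : ℕ} (α β : Fin r → K) :
    (pencilPolar A α β).IsHomogeneous (n * r) := by
  refine .add ?_ ?_
  · simpa using isHomogeneous_prod_pencilForm A α β Finset.univ
  · rw [Finset.mul_sum]
    refine .sum _ _ _ fun j _ => ?_
    have := (isHomogeneous_hSum (K := K) A).mul
      ((isHomogeneous_prod_pencilForm A α β (Finset.univ.erase j)).C_mul (α j))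
    have hr : n + n * (Finset.univ.erase j).card = n * r := by
      have := Finset.card_erase_add_one (Finset.mem_univ j)
      rw [Finset.card_univ, Fintype.card_fin] at this
      rw [add_comm, ← Nat.mul_succ, Nat.succ_eq_add_one, this]
    rwa [hr] at this

variable {r : ℕ} {α β : Fin r → K} {T δ : MvPolynomial (Fin (n + 1)) K}

theorem derivation_pencilForm (h₁ : D (hSum K A) = (T - δ) * hSum K A)
    (h₂ : D (hSum K Aᶜ) = T * hSum K Aᶜ) (x y : K) :
    D (pencilForm A x y) = T * pencilForm A x y - δ * (C x * hSum K A) := by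
  rw [pencilForm, map_add, D.leibniz, D.leibniz, derivation_C, derivation_C, h₁, h₂]
  simp only [smul_eq_mul]
  ring

theorem derivation_pencilProd (h₁ : D (hSum K A) = (T - δ) * hSum K A)
    (h₂ : D (hSum K Aᶜ) = T * hSum K Aᶜ) :
    D (pencilProd A α β) = hSum K A * hSum K Aᶜ *
      ((r + 2) * T * ∏ j, pencilForm A (α j) (β j) - δ * pencilPolar A α β) := by
  have hH : D (∏ j, pencilForm A (α j) (β j)) = r * T * ∏ j, pencilForm A (α j) (β j) -
      δ * (hSum K A * ∑ j, C (α j) * ∏ i ∈ Finset.univ.erase j, pencilForm A (α i) (β i)) := by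
    have hr : (r : MvPolynomial (Fin (n + 1)) K) * T * ∏ j, pencilForm A (α j) (β j)
        = ∑ _j : Fin r, T * ∏ j, pencilForm A (α j) (β j) := by
      simp [mul_assoc]
    rw [derivation_finset_prod, hr, Finset.mul_sum, Finset.mul_sum, ← Finset.sum_sub_distrib]
    refine Finset.sum_congr rfl fun j _ => ?_
    rw [derivation_pencilForm h₁ h₂, ← Finset.mul_prod_erase _ _ (Finset.mem_univ j)]
    ring
  rw [pencilProd, D.leibniz, D.leibniz, hH, h₁, h₂, pencilPolar]
  simp only [smul_eq_mul]
  ring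

end Derivations

/-! ### Parametrization of the Jacobian relations -/

section LogField

variable {K : Type*} [Field K] {n r : ℕ}

/-- The coefficient `c` of the Euler field in `logField`, determined by the condition that the
field kills `pencilProd A α β`. -/
def eulerCoeff (A : Finset (Fin (n + 1))) (α β : Fin r → K)
    (v : MvPolynomial (Fin (n + 1)) K × (Fin (n + 1) → MvPolynomial (Fin (n + 1)) K)) :
    MvPolynomial (Fin (n + 1)) K :=
  C (n : K)⁻¹ * (C (r + 2 : K)⁻¹ * (v.1 * pencilPolar A α β)
    - (A.card : MvPolynomial (Fin (n + 1)) K) * (v.1 * ∏ j, pencilForm A (α j) (β j))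
    - ∑ i, X i * v.2 i)

/-- The tuple with entries `xᵢ (c + [i ∈ A] w H + xᵢ eᵢ)`, where `H = ∏ⱼ (αⱼ f₁ + βⱼ f₂)` and
`c = eulerCoeff A α β (w, e)`, as a linear function of `(w, e)`. -/
def logField (A : Finset (Fin (n + 1))) (α β : Fin r → K) :
    (MvPolynomial (Fin (n + 1)) K × (Fin (n + 1) → MvPolynomial (Fin (n + 1)) K))
      →ₗ[MvPolynomial (Fin (n + 1)) K] (Fin (n + 1) → MvPolynomial (Fin (n + 1)) K) where
  toFun v i := X i * (eulerCoeff A α β v +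
    (if i ∈ A then v.1 * ∏ j, pencilForm A (α j) (β j) else 0) + X i * v.2 i)
  map_add' v v' := by
    funext i
    simp only [eulerCoeff, Prod.fst_add, Prod.snd_add, Pi.add_apply, mul_add,
      Finset.sum_add_distrib]
    split_ifs <;> ring
  map_smul' t v := by
    have hs : ∑ i, X i * (t * v.2 i) = t * ∑ i, X i * v.2 i := by
      rw [Finset.mul_sum]
      exact Finset.sum_congr rfl fun i _ => by ring
    funext i
    simp only [eulerCoeff, Prod.smul_fst, Prod.smul_snd, Pi.smul_apply, smul_eq_mul,
      RingHom.id_apply, hs]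
    split_ifs <;> ring

variable {A : Finset (Fin (n + 1))} {α β : Fin r → K}

theorem logField_apply (w : MvPolynomial (Fin (n + 1)) K)
    (e : Fin (n + 1) → MvPolynomial (Fin (n + 1)) K) (i : Fin (n + 1)) :
    logField A α β (w, e) i = X i * (eulerCoeff A α β (w, e) +
      (if i ∈ A then w * ∏ j, pencilForm A (α j) (β j) else 0) + X i * e i) := rfl

theorem sum_ite_add (A : Finset (Fin (n + 1))) (c δ : MvPolynomial (Fin (n + 1)) K)
    (e : Fin (n + 1) → MvPolynomial (Fin (n + 1)) K) :
    ∑ i, (c + (if i ∈ A then δ else 0) + X i * e i) =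
      (n + 1) * c + A.card * δ + ∑ i, X i * e i := by
  rw [Finset.sum_add_distrib, Finset.sum_add_distrib]
  simp

/-- The right-hand equation says that the field with entries `xᵢ (c + [i ∈ A] w H + xᵢ eᵢ)` kills
`pencilProd A α β`: by `mkDerivation_hSum` and `derivation_pencilProd` the value at that product is
`f₁ f₂ H` times the difference of the two sides. -/
theorem eq_eulerCoeff_iff [CharZero K] (hn : n ≠ 0) {c w : MvPolynomial (Fin (n + 1)) K}
    {e : Fin (n + 1) → MvPolynomial (Fin (n + 1)) K} :
    c = eulerCoeff A α β (w, e) ↔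
      (r + 2) * (n * c + A.card * (w * ∏ j, pencilForm A (α j) (β j)) + ∑ i, X i * e i) =
        w * pencilPolar A α β := by
  have h₁ : (C (n : K)⁻¹ : MvPolynomial (Fin (n + 1)) K) * n = 1 := by
    rw [← C_eq_coe_nat, ← C_mul, inv_mul_cancel₀ (Nat.cast_ne_zero.2 hn), C_1]
  have h₂ : (C (r + 2 : K)⁻¹ : MvPolynomial (Fin (n + 1)) K) * (r + 2) = 1 := by
    have h : (r + 2 : MvPolynomial (Fin (n + 1)) K) = C (r + 2 : K) := by
      rw [C_add, C_eq_coe_nat, map_ofNat]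
    have h' : (r + 2 : K) ≠ 0 := by exact_mod_cast (by omega : r + 2 ≠ 0)
    rw [h, ← C_mul, inv_mul_cancel₀ h', C_1]
  unfold eulerCoeff
  constructor
  · rintro rfl
    dsimp only
    generalize ∑ i, X i * e i = s
    linear_combination (r + 2) * (C (r + 2 : K)⁻¹ * (w * pencilPolar A α β)
      - A.card * (w * ∏ j, pencilForm A (α j) (β j)) - s) * h₁ + (w * pencilPolar A α β) * h₂
  · intro h
    dsimp only
    generalize (∑ i, X i * e i) = s at *
    linear_combination -c * h₁ + C (n : K)⁻¹ * C (r + 2 : K)⁻¹ * h -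
      C (n : K)⁻¹ * (n * c + A.card * (w * ∏ j, pencilForm A (α j) (β j)) + s) * h₂

theorem mkDerivation_hSum {c δ : MvPolynomial (Fin (n + 1)) K}
    {a e : Fin (n + 1) → MvPolynomial (Fin (n + 1)) K}
    (ha : ∀ i, a i = X i * (c + (if i ∈ A then δ else 0) + X i * e i))
    (h₁ : ∑ i ∈ A, e i = 0) (h₂ : ∑ i ∈ Aᶜ, e i = 0) :
    mkDerivation K a (hSum K A) =
        (n * c + A.card * δ + ∑ i, X i * e i - δ) * hSum K A ∧
      mkDerivation K a (hSum K Aᶜ) =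
        (n * c + A.card * δ + ∑ i, X i * e i) * hSum K Aᶜ := by
  have hb : ∀ i, mkDerivation K a (X i) = X i * (c + (if i ∈ A then δ else 0) + X i * e i) :=
    fun i => by rw [mkDerivation_X, ha]
  constructor
  · rw [derivation_hSum_of_eq_add hb (c := c + δ) (e := e) (fun i hi => by rw [if_pos hi]) h₁,
      sum_ite_add]
    ring
  · rw [derivation_hSum_of_eq_add hb (c := c) (e := e)
      (fun i hi => by rw [if_neg (Finset.mem_compl.1 hi), add_zero]) h₂, sum_ite_add]
    ring

theorem logField_mem_derZero [CharZero K] (hn : n ≠ 0) {w : MvPolynomial (Fin (n + 1)) K}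
    {e : Fin (n + 1) → MvPolynomial (Fin (n + 1)) K}
    (h₁ : ∑ i ∈ A, e i = 0) (h₂ : ∑ i ∈ Aᶜ, e i = 0) :
    logField A α β (w, e) ∈ derZero (pencilProd A α β) := by
  obtain ⟨hf₁, hf₂⟩ := mkDerivation_hSum (logField_apply (A := A) (α := α) (β := β) w e) h₁ h₂
  rw [mem_derZero_iff, derivation_pencilProd hf₁ hf₂]
  have h := (eq_eulerCoeff_iff (A := A) (α := α) (β := β) (w := w) (e := e) hn).1 rfl
  rw [h]
  ring

theorem X_dvd_pencilProd (A : Finset (Fin (n + 1))) (α β : Fin r → K) (i : Fin (n + 1)) :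
    X i ∣ pencilProd A α β := by
  refine Dvd.dvd.mul_right ?_ _
  by_cases hi : i ∈ A
  · exact (X_dvd_hSum fun h => Finset.mem_compl.1 h hi).mul_left _
  · exact (X_dvd_hSum hi).mul_right _

/-- Every Jacobian relation comes from the parametrization. A relation `a` is logarithmic along
each square-free factor. Along `xᵢ` this says `aᵢ = xᵢ bᵢ`; along `f₁` and `f₂` it says that `bᵢ`
is congruent modulo `xᵢ` to one polynomial `c₁` for all `i ∈ A` and to one polynomial `c₂` for all
`i ∉ A`; along the other members of the pencil it says that their product divides `c₁ - c₂`. -/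
theorem exists_eq_logField [CharZero K] (hn : n ≠ 0) (hA : A.Nonempty) (hA' : Aᶜ.Nonempty)
    (hαβ : IsGeneralPosition α β) {a : Fin (n + 1) → MvPolynomial (Fin (n + 1)) K}
    (ha : a ∈ derZero (pencilProd A α β)) :
    ∃ (w : MvPolynomial (Fin (n + 1)) K) (e : Fin (n + 1) → MvPolynomial (Fin (n + 1)) K),
      ∑ i ∈ A, e i = 0 ∧ ∑ i ∈ Aᶜ, e i = 0 ∧ a = logField A α β (w, e) := by
  rw [mem_derZero_iff] at ha
  have hsq := squarefree_pencilProd hA hA' hαβ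
  have hlog : ∀ g, g ∣ pencilProd A α β → g ∣ mkDerivation K a g := by
    rintro g ⟨q, hq⟩
    rw [hq] at ha hsq
    exact dvd_derivation_of_squarefree_mul _ (squarefree_mul_iff.1 hsq).1 ha
  have hX : ∀ i, X i ∣ a i := fun i => by
    simpa using hlog _ (X_dvd_pencilProd A α β i)
  choose b hb using hX
  have hDX : ∀ i, mkDerivation K a (X i) = X i * b i := fun i => by rw [mkDerivation_X, hb]
  obtain ⟨c₁, e₁, hbe₁, he₁⟩ := exists_eq_add_of_hSum_dvd hDX
    (hlog (hSum K A) ((dvd_mul_right _ _).mul_right _))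
  obtain ⟨c₂, e₂, hbe₂, he₂⟩ := exists_eq_add_of_hSum_dvd hDX
    (hlog (hSum K Aᶜ) ((dvd_mul_left _ _).mul_right _))
  set e : Fin (n + 1) → MvPolynomial (Fin (n + 1)) K :=
    fun i => if i ∈ A then e₁ i else e₂ i with he
  have hs₁ : ∑ i ∈ A, e i = 0 := by
    rw [← he₁]
    exact Finset.sum_congr rfl fun i hi => if_pos hi
  have hs₂ : ∑ i ∈ Aᶜ, e i = 0 := by
    rw [← he₂]
    exact Finset.sum_congr rfl fun i hi => if_neg (Finset.mem_compl.1 hi)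
  have hae : ∀ i, a i = X i * (c₂ + (if i ∈ A then c₁ - c₂ else 0) + X i * e i) := fun i => by
    by_cases hi : i ∈ A
    · simp only [hb, he, if_pos hi, hbe₁ i hi]
      ring
    · simp only [hb, he, if_neg hi, hbe₂ i (Finset.mem_compl.2 hi)]
      ring
  obtain ⟨hf₁, hf₂⟩ := mkDerivation_hSum hae hs₁ hs₂
  have hdvd : ∏ j, pencilForm A (α j) (β j) ∣ c₁ - c₂ := by
    refine Fintype.prod_dvd_of_isRelPrime
      (fun i j hij => isRelPrime_pencilForm hA hA' (hαβ.det_ne_zero i j hij)) fun j => ?_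
    have h := hlog (pencilForm A (α j) (β j))
      ((Finset.dvd_prod_of_mem _ (Finset.mem_univ j)).mul_left _)
    rw [derivation_pencilForm hf₁ hf₂, dvd_sub_right (dvd_mul_left _ _)] at h
    have hu : IsUnit (C (α j) : MvPolynomial (Fin (n + 1)) K) :=
      IsUnit.map C (isUnit_iff_ne_zero.2 (hαβ.left_ne_zero j))
    rw [← mul_assoc] at h
    exact hu.dvd_mul_right.1
      ((isRelPrime_hSum_pencilForm hA hA' hαβ j).symm.dvd_of_dvd_mul_right h)
  obtain ⟨w, hw⟩ := hdvd
  rw [mul_comm] at hw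
  refine ⟨w, e, hs₁, hs₂, ?_⟩
  have hc : c₂ = eulerCoeff A α β (w, e) := by
    rw [eq_eulerCoeff_iff hn, ← hw]
    rw [derivation_pencilProd hf₁ hf₂] at ha
    have hne : hSum K A * hSum K Aᶜ * ∏ j, pencilForm A (α j) (β j) ≠ 0 := hsq.ne_zero
    refine mul_left_cancel₀ hne ?_
    linear_combination ha + hSum K A * hSum K Aᶜ * pencilPolar A α β * hw
  funext i
  rw [logField_apply, hae, hw, hc]

theorem eq_zero_of_logField_eq_zero (hA : A.Nonempty) (hA' : Aᶜ.Nonempty)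
    (hαβ : IsGeneralPosition α β) {w : MvPolynomial (Fin (n + 1)) K}
    {e : Fin (n + 1) → MvPolynomial (Fin (n + 1)) K}
    (h₁ : ∑ i ∈ A, e i = 0) (h₂ : ∑ i ∈ Aᶜ, e i = 0) (h : logField A α β (w, e) = 0) :
    w = 0 ∧ e = 0 := by
  set c := eulerCoeff A α β (w, e) with hc
  have hi : ∀ i, c + (if i ∈ A then w * ∏ j, pencilForm A (α j) (β j) else 0) + X i * e i = 0 :=
    fun i => (mul_eq_zero.1 (congrFun h i)).resolve_left (X_ne_zero i)
  -- weighting these equations by the `hᵢ` and summing over `A` or `Aᶜ` eliminates `e`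
  have key : ∀ (B : Finset (Fin (n + 1))) (t : MvPolynomial (Fin (n + 1)) K), B.Nonempty →
      ∑ i ∈ B, e i = 0 → (∀ i ∈ B, t + X i * e i = 0) → t = 0 := fun B t hB hs hB0 => by
    have hsum := sum_add_X_mul_mul_hForm (A := B) t e
    rw [hs, mul_zero, add_zero,
      Finset.sum_eq_zero fun i hi => by rw [hB0 i hi, zero_mul]] at hsum
    exact (mul_eq_zero.1 hsum.symm).resolve_right (hSum_ne_zero hB)
  have hc0 : c = 0 := key Aᶜ c hA' h₂ fun i hiA => by
    have := hi i
    rwa [if_neg (Finset.mem_compl.1 hiA), add_zero] at this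
  have hw : c + w * ∏ j, pencilForm A (α j) (β j) = 0 := key A _ hA h₁ fun i hiA => by
    have := hi i
    rwa [if_pos hiA] at this
  rw [hc0, zero_add] at hw
  have hH : ∏ j, pencilForm A (α j) (β j) ≠ 0 :=
    right_ne_zero_of_mul (squarefree_pencilProd hA hA' hαβ).ne_zero
  refine ⟨(mul_eq_zero.1 hw).resolve_right hH, funext fun i => ?_⟩
  have := hi i
  rw [hc0, hw, ite_self, add_zero, zero_add] at this
  exact (mul_eq_zero.1 this).resolve_left (X_ne_zero i)

end LogField

/-! ### The basis of Jacobian relations -/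

section BasisField

variable {K : Type*} [Field K] {n r : ℕ} {A : Finset (Fin (n + 1))} {α β : Fin r → K}
  {p q : Fin (n + 1)}

/-- The vector `εₖ - ε_q` for `k ∈ A` and `εₖ - ε_p` for `k ∉ A`. When `q ∈ A` and `p ∉ A`, its
entries in `A` and those off `A` sum to zero. -/
def diffVector (K : Type*) [Field K] {n : ℕ} (A : Finset (Fin (n + 1))) (p q k : Fin (n + 1)) :
    Fin (n + 1) → MvPolynomial (Fin (n + 1)) K :=
  Pi.single k 1 - Pi.single (if k ∈ A then q else p) 1

theorem sum_diffVector (hp : p ∉ A) (hq : q ∈ A) (k : Fin (n + 1)) :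
    ∑ i ∈ A, diffVector K A p q k i = 0 := by
  simp only [diffVector, Pi.sub_apply, Finset.sum_sub_distrib]
  by_cases hk : k ∈ A <;> simp [hk, hp, hq]

theorem sum_compl_diffVector (hp : p ∉ A) (hq : q ∈ A) (k : Fin (n + 1)) :
    ∑ i ∈ Aᶜ, diffVector K A p q k i = 0 := by
  simp only [diffVector, Pi.sub_apply, Finset.sum_sub_distrib]
  by_cases hk : k ∈ A <;> simp [hk, hp, hq]

theorem isHomogeneous_diffVector (k i : Fin (n + 1)) :
    (diffVector K A p q k i).IsHomogeneous 0 := by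
  have h : ∀ l : Fin (n + 1),
      ((Pi.single l 1 : Fin (n + 1) → MvPolynomial (Fin (n + 1)) K) i).IsHomogeneous 0 := fun l => by
    rw [Pi.single_apply]
    split_ifs
    · exact isHomogeneous_one _ _
    · exact isHomogeneous_zero _ _ _
  exact (h k).sub (h _)

theorem diffVector_self (hq : q ∈ A) : diffVector K A p q q = 0 := by
  simp [diffVector, hq]

theorem sum_smul_diffVector_apply {τ : Fin n → Fin (n + 1)} (hτ : Function.Injective τ)
    (u : Fin n → MvPolynomial (Fin (n + 1)) K) {j : Fin n} (hjp : τ j ≠ p) (hjq : τ j ≠ q) :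
    (∑ k, u k • diffVector K A p q (τ k)) (τ j) = u j := by
  rw [Finset.sum_apply, Finset.sum_eq_single j]
  · have : τ j ≠ if τ j ∈ A then q else p := by split_ifs <;> assumption
    simp [diffVector, this]
  · intro k _ hk
    have h₁ : τ j ≠ τ k := fun h => hk (hτ h).symm
    have h₂ : τ j ≠ if τ k ∈ A then q else p := by split_ifs <;> assumption
    simp [diffVector, h₁, h₂]
  · simp

/-- A vector whose partial sums over `B` vanish and which is supported at one point of `B` is zero
on `B`. -/
theorem eq_zero_of_sum_eq_zero {M ι : Type*} [AddCommMonoid M] {B : Finset ι} {e : ι → M} {x : ι}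
    (h : ∑ i ∈ B, e i = 0) (h0 : ∀ i ∈ B, i ≠ x → e i = 0) {i : ι} (hi : i ∈ B) : e i = 0 := by
  by_cases hx : i = x
  · subst hx
    rwa [Finset.sum_eq_single_of_mem i hi fun j hj => h0 j hj] at h
  · exact h0 i hi hx

theorem isHomogeneous_logField_diffVector (k i : Fin (n + 1)) :
    (logField A α β (0, diffVector K A p q k) i).IsHomogeneous 2 := by
  have h : ∀ i, (X i * diffVector K A p q k i).IsHomogeneous 1 := fun i =>
    (isHomogeneous_X K i).mul (isHomogeneous_diffVector k i)
  rw [logField_apply, zero_mul, ite_self, add_zero]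
  refine (isHomogeneous_X K i).mul (.add ?_ (h i))
  simp only [eulerCoeff, zero_mul, mul_zero, sub_zero, zero_sub]
  exact (IsHomogeneous.sum _ _ _ fun i _ => h i).neg.C_mul _

theorem isHomogeneous_logField_one_zero (i : Fin (n + 1)) :
    (logField A α β (1, 0) i).IsHomogeneous (n * r + 1) := by
  have hH : (∏ j, pencilForm A (α j) (β j)).IsHomogeneous (n * r) := by
    simpa using isHomogeneous_prod_pencilForm A α β Finset.univ
  rw [logField_apply, one_mul, add_comm (n * r)]
  refine (isHomogeneous_X K i).mul (.add (.add ?_ ?_) ?_)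
  · simp only [eulerCoeff, one_mul, Pi.zero_apply, mul_zero, Finset.sum_const_zero, sub_zero]
    rw [← C_eq_coe_nat]
    exact (((isHomogeneous_pencilPolar A α β).C_mul _).sub (hH.C_mul _)).C_mul _
  · split_ifs
    · exact hH
    · exact isHomogeneous_zero _ _ _
  · rw [Pi.zero_apply, mul_zero]
    exact isHomogeneous_zero _ _ _

/-- The free parameters of the Jacobian relations are `w` and the entries `eᵢ` with `i ≠ p, q`,
where `p ∉ A` and `q ∈ A`; the basis element of `w` has degree `nr + 1`, the others `2`. -/
theorem isFreeWithExponents_pencilProd [CharZero K] (hp : p ∉ A) (hq : q ∈ A)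
    (hαβ : IsGeneralPosition α β) (s : Fin n) :
    IsFreeWithExponents (pencilProd A α β) (fun i : Fin n => if i = s then n * r + 1 else 2) := by
  have hn : n ≠ 0 := fun h => by subst h; exact s.elim0
  have hA : A.Nonempty := ⟨q, hq⟩
  have hA' : Aᶜ.Nonempty := ⟨p, Finset.mem_compl.2 hp⟩
  have hsq := squarefree_pencilProd hA hA' hαβ
  have hdeg := (isHomogeneous_pencilProd A α β).totalDegree hsq.ne_zero
  obtain ⟨q', hq'⟩ := Fin.exists_succAbove_eq (x := q) (y := p) fun h => hp (h ▸ hq)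
  -- an enumeration of the indices other than `p`, with `q` in the place of `w`
  let τ : Fin n → Fin (n + 1) := fun j => p.succAbove (Equiv.swap s q' j)
  have hτ : Function.Injective τ := fun i j h =>
    (Equiv.swap s q').injective (Fin.succAbove_right_injective h)
  have hτs : τ s = q := by simp [τ, hq']
  have hτp : ∀ j, τ j ≠ p := fun j => Fin.succAbove_ne _ _
  have hτq : ∀ j, j ≠ s → τ j ≠ q := fun j hj h => hj (hτ (h.trans hτs.symm))
  have hτsurj : ∀ i, i ≠ p → ∃ j, τ j = i := fun i hi => by
    obtain ⟨j, hj⟩ := Fin.exists_succAbove_eq hi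
    exact ⟨(Equiv.swap s q').symm j, by simp [τ, hj]⟩
  let v : Fin n → derZero (pencilProd A α β) := fun j =>
    ⟨logField A α β (if j = s then 1 else 0, diffVector K A p q (τ j)),
      logField_mem_derZero hn (sum_diffVector hp hq _) (sum_compl_diffVector hp hq _)⟩
  have hsum : ∀ u : Fin n → MvPolynomial (Fin (n + 1)) K,
      ((∑ j, u j • v j : derZero (pencilProd A α β)) : Fin (n + 1) → _) =
        logField A α β (u s, ∑ j, u j • diffVector K A p q (τ j)) := fun u => by
    have h : (u s, ∑ j, u j • diffVector K A p q (τ j)) =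
        ∑ j, u j • ((if j = s then 1 else 0 : MvPolynomial (Fin (n + 1)) K),
          diffVector K A p q (τ j)) := by
      refine Prod.ext ?_ ?_
      · simp [Prod.fst_sum]
      · simp [Prod.snd_sum]
    rw [h, map_sum, AddSubmonoidClass.coe_finsetSum]
    exact Finset.sum_congr rfl fun j _ => by rw [map_smul, Submodule.coe_smul]
  have hzero : ∀ (B : Finset (Fin (n + 1))) (u : Fin n → MvPolynomial (Fin (n + 1)) K),
      (∀ k, ∑ i ∈ B, diffVector K A p q k i = 0) →
        ∑ i ∈ B, (∑ j, u j • diffVector K A p q (τ j)) i = 0 := fun B u hB => by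
    simp only [Finset.sum_apply, Pi.smul_apply]
    rw [Finset.sum_comm]
    exact Finset.sum_eq_zero fun j _ => by rw [← Finset.smul_sum, hB, smul_zero]
  have hli : LinearIndependent (MvPolynomial (Fin (n + 1)) K) v := by
    rw [Fintype.linearIndependent_iff]
    intro u hu j
    have h0 := hsum u
    rw [hu, Submodule.coe_zero] at h0
    obtain ⟨hw, he⟩ := eq_zero_of_logField_eq_zero hA hA' hαβ
      (hzero A u (sum_diffVector hp hq)) (hzero Aᶜ u (sum_compl_diffVector hp hq)) h0.symm
    by_cases hj : j = s
    · rw [hj, hw]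
    · rw [← sum_smul_diffVector_apply (A := A) hτ u (hτp j) (hτq j hj), he, Pi.zero_apply]
  have hsp : ⊤ ≤ Submodule.span (MvPolynomial (Fin (n + 1)) K) (Set.range v) := by
    rintro ⟨a, ha⟩ -
    obtain ⟨w, e, h₁, h₂, rfl⟩ := exists_eq_logField hn hA hA' hαβ ha
    rw [Submodule.mem_span_range_iff_exists_fun]
    let u : Fin n → MvPolynomial (Fin (n + 1)) K := fun j => if j = s then w else e (τ j)
    refine ⟨u, Subtype.ext ?_⟩
    have hus : u s = w := if_pos rfl
    have hoff : ∀ i, i ≠ p → i ≠ q →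
        (∑ j, u j • diffVector K A p q (τ j) - e) i = 0 := fun i hip hiq => by
      obtain ⟨j, rfl⟩ := hτsurj i hip
      have hj : j ≠ s := fun h => hiq (by rw [h, hτs])
      rw [Pi.sub_apply, sum_smul_diffVector_apply hτ u hip hiq]
      simp [u, hj]
    have he : ∑ j, u j • diffVector K A p q (τ j) = e := by
      refine sub_eq_zero.1 (funext fun i => ?_)
      by_cases hi : i ∈ A
      · refine eq_zero_of_sum_eq_zero (B := A) (x := q) ?_
          (fun k hk => hoff k fun h => hp (h ▸ hk)) hi
        simp only [Pi.sub_apply, Finset.sum_sub_distrib]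
        rw [hzero A u (sum_diffVector hp hq), h₁, sub_zero]
      · refine eq_zero_of_sum_eq_zero (B := Aᶜ) (x := p) ?_
          (fun k hk hkp => hoff k hkp fun h => Finset.mem_compl.1 hk (h ▸ hq))
          (Finset.mem_compl.2 hi)
        simp only [Pi.sub_apply, Finset.sum_sub_distrib]
        rw [hzero Aᶜ u (sum_compl_diffVector hp hq), h₂, sub_zero]
    rw [hsum, hus, he]
  refine ⟨?_, hsq, ⟨Module.Basis.mk hli hsp, fun j i => ?_⟩, ?_⟩
  · rw [hdeg]
    exact isHomogeneous_pencilProd A α β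
  · rw [Module.Basis.mk_apply]
    by_cases hj : j = s
    · have hv : (v j : Fin (n + 1) → _) = logField A α β (1, 0) := by
        simp only [v, if_pos hj]
        rw [hj, hτs, diffVector_self hq]
      rw [hv, if_pos hj]
      exact isHomogeneous_logField_one_zero i
    · have hv : (v j : Fin (n + 1) → _) = logField A α β (0, diffVector K A p q (τ j)) := by
        simp only [v, if_neg hj]
      rw [hv, if_neg hj]
      exact isHomogeneous_logField_diffVector _ i
  · rw [hdeg, ← Finset.add_sum_erase _ _ (Finset.mem_univ s), if_pos rfl,
      Finset.sum_congr rfl fun i hi => if_neg (Finset.ne_of_mem_erase hi), Finset.sum_const,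
      Finset.card_erase_of_mem (Finset.mem_univ s), Finset.card_univ, Fintype.card_fin,
      smul_eq_mul, mul_add]
    omega

end BasisField

/-! ### Generic members of the pencil -/

/-- The polynomial `∏ aᵢ bᵢ ∏_{i ≠ j} (aᵢ bⱼ - aⱼ bᵢ)` in the coefficients of `r` members of the
pencil, nonzero exactly at the points in general position. -/
def generalPositionPoly (K : Type*) [Field K] (r : ℕ) : MvPolynomial (Fin r × Fin 2) K :=
  (∏ i, X (i, 0) * X (i, 1)) *
    ∏ ij ∈ (Finset.univ : Finset (Fin r)).offDiag,
      (X (ij.1, 0) * X (ij.2, 1) - X (ij.2, 0) * X (ij.1, 1))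

theorem generalPositionPoly_ne_zero (K : Type*) [Field K] (r : ℕ) :
    generalPositionPoly K r ≠ 0 := by
  refine mul_ne_zero (Finset.prod_ne_zero_iff.2 fun i _ => mul_ne_zero (X_ne_zero _) (X_ne_zero _))
    (Finset.prod_ne_zero_iff.2 fun ij hij h0 => ?_)
  have hne : ij.1 ≠ ij.2 := (Finset.mem_offDiag.1 hij).2.2
  have h := congrArg (eval fun t : Fin r × Fin 2 =>
    if t = (ij.1, 0) ∨ t = (ij.2, 1) then (1 : K) else 0) h0
  simp [hne, hne.symm] at h

theorem isGeneralPosition_of_eval_ne_zero {K : Type*} [Field K] {r : ℕ} {c : Fin r × Fin 2 → K}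
    (h : eval c (generalPositionPoly K r) ≠ 0) :
    IsGeneralPosition (fun i => c (i, 0)) fun i => c (i, 1) := by
  simp only [generalPositionPoly, map_mul, map_prod, map_sub, eval_X] at h
  have h₁ := Finset.prod_ne_zero_iff.1 (left_ne_zero_of_mul h)
  have h₂ := Finset.prod_ne_zero_iff.1 (right_ne_zero_of_mul h)
  exact ⟨fun j => left_ne_zero_of_mul (h₁ j (Finset.mem_univ j)),
    fun j => right_ne_zero_of_mul (h₁ j (Finset.mem_univ j)),
    fun i j hij => h₂ (i, j) (Finset.mem_offDiag.2 ⟨Finset.mem_univ i, Finset.mem_univ j, hij⟩)⟩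

theorem fTwo_eq_hSum_compl (K : Type*) [Field K] (n m : ℕ) :
    fTwo K n m = hSum K (Finset.univ.filter fun i : Fin (n + 1) => m < (i : ℕ))ᶜ := by
  rw [fTwo, hSum, Finset.compl_filter]
  simp only [not_lt]

end

theorem theorem4p2 {K : Type*} [Field K] [IsAlgClosed K] [CharZero K]
    (n m ε : ℕ) (hε : ε = 0 ∨ ε = 1) (hn : n = 2 * m + ε) (hn1 : 1 ≤ n) :
    IsFreeWithExponents (fOne K n m * fTwo K n m)
        (fun i : Fin n => if (i : ℕ) = 0 then 1 else 2) ∧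
      ∀ k : ℕ, 3 ≤ k →
        HoldsGenerically (K := K) (σ := Fin (k - 2) × Fin 2) (fun c =>
          IsFreeWithExponents
            (fOne K n m * fTwo K n m *
              ∏ i : Fin (k - 2), pencilMember n m (c (i, 0)) (c (i, 1)))
            (fun i : Fin n => if (i : ℕ) + 1 = n then n * (k - 2) + 1 else 2)) := by
  set A : Finset (Fin (n + 1)) := Finset.univ.filter fun i => m < (i : ℕ) with hA
  have h₁ : fOne K n m = hSum K A := rfl
  have h₂ : fTwo K n m = hSum K Aᶜ := fTwo_eq_hSum_compl K n m
  have hp : (0 : Fin (n + 1)) ∉ A := by simp [hA]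
  have hq : Fin.last n ∈ A := by
    simp only [hA, Finset.mem_filter, Finset.mem_univ, true_and, Fin.val_last]
    omega
  constructor
  · -- the product of no further members of the pencil
    have h := isFreeWithExponents_pencilProd (α := Fin.elim0) (β := Fin.elim0) (K := K) hp hq
      ⟨fun j => j.elim0, fun j => j.elim0, fun j => j.elim0⟩ (⟨0, hn1⟩ : Fin n)
    simpa [pencilProd, h₁, h₂, Fin.ext_iff] using h
  · intro k _
    refine ⟨generalPositionPoly K (k - 2), generalPositionPoly_ne_zero K _, fun c hc => ?_⟩
    have h := isFreeWithExponents_pencilProd hp hq (isGeneralPosition_of_eval_ne_zero hc)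
      (⟨n - 1, by omega⟩ : Fin n)
    have hd : ∀ i : Fin n, i = (⟨n - 1, by omega⟩ : Fin n) ↔ (i : ℕ) + 1 = n := fun i => by
      rw [Fin.ext_iff]
      dsimp only
      omega
    simp only [hd] at h
    simpa only [pencilProd, pencilForm, pencilMember, h₁, h₂] using h
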